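/- Let $\mathcal C$ be an integral domain, $x=(x_1,\dots,x_n)$ indeterminates, and let $\preceq$ be an arbitrary monomial order on $\mathbb N^n$, i.e. a total order such that $\alpha\prec\beta$ implies $\alpha+\gamma\prec\beta+\gamma$ for all $\gamma\in\mathbb N^n$ (it need not be a well-ordering). For a ring $R$ and a non-zero $f=\sum_\alpha c_\alpha x^\alpha\in R[x]$, put $\exp(f)=\max_{\preceq}\{\alpha : c_\alpha\neq 0\}$. For a field $\mathbf K$ and an ideal $I\subset\mathbf K[x]$, a finite set $G\subset I\smallsetminus\{0\}$ is called a standard basis of $I$ if $$\{\exp(f) : f\in I\smallsetminus\{0\}\}=\bigcup_{g\in G}\bigl(\exp(g)+\mathbb N^n\bigr).$$ A ring homomorphism $\sigma:\mathcal C\to\mathbf K$ to a field is called a specialization; the induced homomorphism $\mathcal C[x]\to\mathbf K[x]$, acting on coefficients, is also denoted by $\sigma$. **Theorem.** Let $J\subset\mathcal C[x]$ and $\mathcal Q\subset\mathcal C$ be finitely generated ideals with $J\not\subseteq\mathcal C[x]\cdot\mathcal Q$. Then there exist a finite set $\mathcal G\subset J$ and finitely many elements $h_1,\dots,h_r\in\mathcal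 C\smallsetminus\mathcal Q$ such that, with $h=\prod_i h_i$, the following holds for all fields $\mathbf K$ and all specializations $\sigma:\mathcal C\to\mathbf K$ with $\sigma(\mathcal Q)=\{0\}$ and $\sigma(h)\neq 0$: 1. $\sigma(\mathcal G)$ is a standard basis of the ideal $\mathbf K[x]\,\sigma(J)$ generated by $\sigma(J)$; 2. for each $g\in\mathcal G$, $\sigma(g)\neq 0$ and $\exp(\sigma(g))\in\mathbb N^n$ does not depend on $\mathbf K$ or $\sigma$. -/

import Mathlib

universe u v

/-- A monomial order in `n` variables: a total order on the exponents `α ∈ ℕⁿ` (identified with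
the monomials `x^α`) that is strictly compatible with addition. It need not be a well-ordering:
global, local and mixed orders are all allowed. -/
structure ArbMonomialOrder (n : ℕ) where
  /-- the order relation `α ≼ β` -/
  le : (Fin n →₀ ℕ) → (Fin n →₀ ℕ) → Prop
  refl : ∀ α, le α α
  antisymm : ∀ α β, le α β → le β α → α = β
  trans : ∀ α β γ, le α β → le β γ → le α γ
  total : ∀ α β, le α β ∨ le β α
  add_lt_add : ∀ α β γ, (le α β ∧ α ≠ β) → (le (α + γ) (β + γ) ∧ α + γ ≠ β + γ)

namespace ArbMonomialOrder

variable {n : ℕ} (m : ArbMonomialOrder n) {R : Type*} [CommRing R]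

/-- `α = exp(f)`, i.e. `α` is the maximum of the support of `f`. There is no such `α` when
`f = 0`, and exactly one when `f ≠ 0`. -/
def IsLeadingExp (f : MvPolynomial (Fin n) R) (α : Fin n →₀ ℕ) : Prop :=
  α ∈ f.support ∧ ∀ β ∈ f.support, m.le β α

/-- `Exp(I) = {exp(f) | f ∈ I, f ≠ 0}`. -/
def leadingExps (I : Ideal (MvPolynomial (Fin n) R)) : Set (Fin n →₀ ℕ) :=
  {α | ∃ f ∈ I, m.IsLeadingExp f α}

/-- `G` is a standard basis of the ideal `I`: a finite set of nonzero elements of `I` such that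
`Exp(I) = ⋃_{g ∈ G} (exp(g) + ℕⁿ)`. -/
structure IsStandardBasis (G : Set (MvPolynomial (Fin n) R))
    (I : Ideal (MvPolynomial (Fin n) R)) : Prop where
  finite : G.Finite
  subset : G ⊆ (I : Set (MvPolynomial (Fin n) R))
  ne_zero : ∀ g ∈ G, g ≠ 0
  leadingExps_eq : m.leadingExps I =
    ⋃ g ∈ G, {α | ∃ ε δ : Fin n →₀ ℕ, m.IsLeadingExp g ε ∧ α = ε + δ}

end ArbMonomialOrder

/-!
Homogenizing the problem turns it into linear algebra, one degree at a time. Let `S` be a finite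
set of generators of `J`. For a specialization `σ`, the ideal generated by `σ(J)` is the increasing
union of the finite-dimensional spaces `truncation σ S D`, spanned by the specializations of the
`x^β f` with `f ∈ S` and `|β| + deg f ≤ D`. No well-ordering is needed: in each of these spaces
there are as many leading exponents as dimensions (`ncard_subspaceExps`), and the pairs `(k, α)`
with `α` a leading exponent in degree `k + |α|` form an upper set `specializedExps σ S` of
`ℕ × ℕⁿ`. By Dickson's lemma such an upper set is finitely generated, and increasing families of
upper sets become stationary.

Choose a minimal prime `p` over `Q` such that the upper set at the residue field of `p` is maximal
for inclusion. Each of its finitely many generators lifts to a polynomial in `J` whose coefficients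
above the leading one lie in the radical of `Q` (`exists_lift_isLeadingExp`). The lifts form the set
`G`, and `h` is the product of their leading coefficients, which avoids `p`.

If `σ(Q) = 0` and `σ(h) ≠ 0`, the upper set of `σ` contains that of `p`, and so does the upper set
of any minimal prime `p' ⊆ ker σ`; the latter is therefore equal to that of `p`. As the rank of a
matrix can only drop when passing from `p'` to `σ`, the dimension count shows that the upper set of
`σ` is not larger (`specializedExps_eq_of_subset`). No Buchberger-type criterion is involved, and
`Q` need not be prime.
-/

open MvPolynomial

/-! ### Upper sets in a well-quasi-order -/

/-- In a well-quasi-order, increasing unions of upper sets become stationary. The order of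
`UpperSet` is reverse inclusion, so this says that every nonempty family of upper sets has a
member that is maximal for inclusion. -/
theorem UpperSet.wellFoundedLT_of_wellQuasiOrderedLE {α : Type*} [Preorder α]
    [WellQuasiOrderedLE α] : WellFoundedLT (UpperSet α) := by
  refine ⟨RelEmbedding.wellFounded_iff_isEmpty.2 ⟨fun f => ?_⟩⟩
  have hlt : ∀ i j, i < j → f j < f i := fun i j h => f.map_rel_iff.2 h
  have hex : ∀ i, ∃ x, x ∈ f (i + 1) ∧ x ∉ f i := fun i => by
    have h : (f i : Set α) ⊂ f (i + 1) := hlt i (i + 1) (Nat.lt_succ_self i)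
    exact Set.exists_of_ssubset h
  choose x hx hx' using hex
  obtain ⟨i, j, hij, hle⟩ := wellQuasiOrdered_le x
  have hsub : (f (i + 1) : Set α) ⊆ f j := by
    rcases (Nat.succ_le_of_lt hij).eq_or_lt with h | h
    · rw [← h]
    · exact (hlt _ _ h).le
  exact hx' j ((f j).upper hle (hsub (hx i)))

/-- Dickson's lemma: an upper set of a well-quasi-ordered partial order is generated by finitely
many of its elements. -/
theorem UpperSet.exists_finset_generators {α : Type*} [PartialOrder α] [WellQuasiOrderedLE α]
    (s : UpperSet α) : ∃ t : Finset α, (∀ a ∈ t, a ∈ s) ∧ ∀ b ∈ s, ∃ a ∈ t, a ≤ b := by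
  have hfin : {a | Minimal (· ∈ (s : Set α)) a}.Finite :=
    WellQuasiOrderedLE.finite_of_isAntichain (setOfPred_minimal_antichain _)
  refine ⟨hfin.toFinset, fun a ha => (hfin.mem_toFinset.1 ha).prop, fun b hb => ?_⟩
  obtain ⟨a, hab, ha⟩ := (Set.isPWO_of_wellQuasiOrderedLE (s : Set α)).exists_le_minimal hb
  exact ⟨a, hfin.mem_toFinset.2 ha, hab⟩

/-! ### Minimal primes -/

/-- The localization at a minimal prime `p` over `Q` has `p` as the radical of `Q`: an element of
`p` is multiplied into the radical of `Q` by some element outside `p`. -/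
theorem Ideal.exists_notMem_mul_mem_radical {R : Type*} [CommRing R] {Q p : Ideal R}
    (hp : p ∈ Q.minimalPrimes) {a : R} (ha : a ∈ p) : ∃ s ∉ p, s * a ∈ Q.radical := by
  have : p.IsPrime := hp.1.1
  by_contra! hcon
  have hdisj : Disjoint (Q : Set R) (Submonoid.powers a ⊔ p.primeCompl : Submonoid R) := by
    rw [Set.disjoint_left]
    intro x hxQ hx
    obtain ⟨y, ⟨k, rfl⟩, s, hs, rfl⟩ := Submonoid.mem_sup.1 hx
    refine hcon s hs ⟨k + 1, ?_⟩
    have : (s * a) ^ (k + 1) = (s ^ k * a) * (a ^ k * s) := by ring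
    rw [this]
    exact Q.mul_mem_left _ hxQ
  obtain ⟨q, hq, hQq, hqd⟩ := Ideal.exists_le_prime_disjoint _ _ hdisj
  rw [Set.disjoint_left] at hqd
  have hqp : q ≤ p := fun x hx => by
    by_contra hxp
    exact hqd hx ((le_sup_right : p.primeCompl ≤ _) hxp)
  exact hqd (hp.2 ⟨hq, hQq⟩ hqp ha)
    ((le_sup_left : Submonoid.powers a ≤ _) (Submonoid.mem_powers a))

theorem Ideal.exists_notMem_forall_mul_mem_radical {R : Type*} [CommRing R] {Q p : Ideal R}
    (hp : p ∈ Q.minimalPrimes) (T : Finset R) (hT : ∀ a ∈ T, a ∈ p) :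
    ∃ s ∉ p, ∀ a ∈ T, s * a ∈ Q.radical := by
  classical
  have : p.IsPrime := hp.1.1
  induction T using Finset.induction_on with
  | empty => exact ⟨1, p.primeCompl.one_mem, by simp⟩
  | insert b T _ ih =>
    obtain ⟨s, hs, h⟩ := ih fun a ha => hT a (Finset.mem_insert_of_mem ha)
    obtain ⟨t, ht, h'⟩ := Ideal.exists_notMem_mul_mem_radical hp (hT b (Finset.mem_insert_self _ _))
    refine ⟨s * t, p.primeCompl.mul_mem hs ht, fun a ha => ?_⟩
    rcases Finset.mem_insert.1 ha with rfl | ha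
    · rw [mul_assoc]; exact Ideal.mul_mem_left _ _ h'
    · rw [mul_right_comm]; exact Ideal.mul_mem_right _ _ (h a ha)

/-! ### Clearing denominators and semicontinuity of rank -/

/-- Clearing denominators: every vector in the span of the image of `A` over the residue field
`κ(p)` has a multiple, by an element outside `p`, that lifts to the span of `A`. -/
theorem MvPolynomial.exists_lift_mem_span {R ι : Type*} [CommRing R] (p : Ideal R) [p.IsPrime]
    (A : Set (MvPolynomial ι R)) {f : MvPolynomial ι p.ResidueField}
    (hf : f ∈ Submodule.span p.ResidueField (map (algebraMap R p.ResidueField) '' A)) :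
    ∃ s ∉ p, ∃ F ∈ Submodule.span R A,
      map (algebraMap R p.ResidueField) F = algebraMap R p.ResidueField s • f := by
  induction hf using Submodule.span_induction with
  | mem x hx =>
    obtain ⟨F, hF, rfl⟩ := hx
    exact ⟨1, p.primeCompl.one_mem, F, Submodule.subset_span hF, by simp⟩
  | zero => exact ⟨1, p.primeCompl.one_mem, 0, zero_mem _, by simp⟩
  | add x y _ _ hx hy =>
    obtain ⟨s, hs, F, hF, hFx⟩ := hx
    obtain ⟨t, ht, G, hG, hGy⟩ := hy
    refine ⟨s * t, p.primeCompl.mul_mem hs ht, t • F + s • G,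
      add_mem (Submodule.smul_mem _ _ hF) (Submodule.smul_mem _ _ hG), ?_⟩
    simp only [smul_eq_C_mul, map_add, map_mul, map_C, hFx, hGy]
    ring
  | smul c x _ hx =>
    obtain ⟨s, hs, F, hF, hFx⟩ := hx
    obtain ⟨a, b, hb, rfl⟩ := IsFractionRing.div_surjective (A := R ⧸ p) c
    obtain ⟨a, rfl⟩ := Ideal.Quotient.mk_surjective a
    obtain ⟨b, rfl⟩ := Ideal.Quotient.mk_surjective b
    have hbp : b ∉ p := fun h =>
      nonZeroDivisors.ne_zero hb (Ideal.Quotient.eq_zero_iff_mem.2 h)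
    have hb0 : algebraMap R p.ResidueField b ≠ 0 := fun h =>
      hbp (Ideal.algebraMap_residueField_eq_zero.1 h)
    refine ⟨s * b, p.primeCompl.mul_mem hs hbp, a • F, Submodule.smul_mem _ _ hF, ?_⟩
    rw [smul_eq_C_mul, map_mul, map_C, hFx, ← smul_eq_C_mul, smul_smul, smul_smul, map_mul]
    congr 1
    simp only [Ideal.algebraMap_quotient_residueField_mk]
    field_simp

/-- The coefficient vectors of a linearly independent finite family of polynomials span the whole
space, so that some square submatrix of its coefficient matrix is invertible. -/
theorem MvPolynomial.exists_det_coeff_ne_zero {K ι κ : Type*} [Field K] [Fintype κ]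
    [DecidableEq κ] (v : κ → MvPolynomial ι K) (hv : LinearIndependent K v) :
    ∃ e : κ → (ι →₀ ℕ), (Matrix.of fun i j => coeff (e j) (v i)).det ≠ 0 := by
  let c : (ι →₀ ℕ) → κ → K := fun α i => coeff α (v i)
  have htop : Submodule.span K (Set.range c) = ⊤ := by
    by_contra hne
    obtain ⟨φ, hφ, hle⟩ := Submodule.exists_le_ker_of_lt_top _ (lt_top_iff_ne_top.2 hne)
    apply hφ
    have hsum : ∑ i, φ (Pi.single i 1) • v i = 0 := by
      ext α
      have h0 : φ (c α) = 0 := hle (Submodule.subset_span ⟨α, rfl⟩)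
      rw [LinearMap.pi_apply_eq_sum_univ] at h0
      simp only [coeff_sum, coeff_smul, coeff_zero, smul_eq_mul]
      rw [← h0]
      refine Finset.sum_congr rfl fun i _ => ?_
      rw [smul_eq_mul, mul_comm]
      congr 2
      ext j
      simp [Pi.single_apply, eq_comm]
    have hz := Fintype.linearIndependent_iff.1 hv _ hsum
    refine LinearMap.pi_ext' fun i => ?_
    ext
    simpa using hz i
  obtain ⟨κ', a, -, hspan, hli⟩ := exists_linearIndependent' K c
  let b : Module.Basis κ' K (κ → K) := Module.Basis.mk hli (by rw [hspan, htop])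
  let ε : κ ≃ κ' := (Pi.basisFun K κ).indexEquiv b
  refine ⟨a ∘ ε, ?_⟩
  have hcol : LinearIndependent K
      (Matrix.of fun i j => coeff ((a ∘ ε) j) (v i) : Matrix κ κ K).col :=
    hli.comp ε ε.injective
  exact ((Matrix.isUnit_iff_isUnit_det _).1
    (Matrix.linearIndependent_cols_iff_isUnit.1 hcol)).ne_zero

/-- Semicontinuity of rank: if `ker τ ⊆ ker σ`, a minor that does not vanish under `σ` does not
vanish under `τ`. -/
theorem MvPolynomial.linearIndependent_map_of_ker_le {R K L ι κ : Type*} [CommRing R] [Field K]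
    [Field L] [Finite κ] (σ : R →+* K) (τ : R →+* L) (h : RingHom.ker τ ≤ RingHom.ker σ)
    (v : κ → MvPolynomial ι R) (hv : LinearIndependent K fun i => map σ (v i)) :
    LinearIndependent L fun i => map τ (v i) := by
  classical
  have := Fintype.ofFinite κ
  obtain ⟨e, he⟩ := exists_det_coeff_ne_zero _ hv
  let N : Matrix κ κ R := Matrix.of fun i j => coeff (e j) (v i)
  have hσ : σ N.det ≠ 0 := by
    rw [RingHom.map_det]
    convert he using 2
    ext i j
    simp [N, coeff_map]
  have hτ : τ N.det ≠ 0 := fun h0 => hσ (h h0)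
  rw [RingHom.map_det] at hτ
  have hrow : LinearIndependent L (τ.mapMatrix N).row :=
    Matrix.linearIndependent_rows_iff_isUnit.2
      ((Matrix.isUnit_iff_isUnit_det _).2 (isUnit_iff_ne_zero.2 hτ))
  let ψ : MvPolynomial ι L →ₗ[L] (κ → L) := LinearMap.pi fun j => lcoeff L (e j)
  refine LinearIndependent.of_comp ψ ?_
  convert hrow using 1
  ext i j
  simp [ψ, N, coeff_map, Matrix.row]

theorem MvPolynomial.finrank_span_map_image_le {R K L ι : Type*} [CommRing R] [Field K] [Field L]
    (σ : R →+* K) (τ : R →+* L) (h : RingHom.ker τ ≤ RingHom.ker σ)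
    {A : Set (MvPolynomial ι R)} (hA : A.Finite) :
    Module.finrank K (Submodule.span K (map σ '' A)) ≤
      Module.finrank L (Submodule.span L (map τ '' A)) := by
  obtain ⟨κ, a, ha, hspan, hli⟩ :=
    exists_linearIndependent' K fun x : A => map σ (x : MvPolynomial ι R)
  have := hA.to_subtype
  have : Finite κ := Finite.of_injective a ha
  have := Fintype.ofFinite κ
  have hτ := linearIndependent_map_of_ker_le σ τ h (fun i => (a i : MvPolynomial ι R)) hli
  have : FiniteDimensional L (Submodule.span L (map τ '' A)) :=
    FiniteDimensional.span_of_finite L (hA.image _)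
  rw [Set.image_eq_range, ← hspan, finrank_span_eq_card hli, ← finrank_span_eq_card hτ]
  refine Submodule.finrank_mono (Submodule.span_mono ?_)
  rintro _ ⟨i, rfl⟩
  exact ⟨a i, (a i).2, rfl⟩

namespace ArbMonomialOrder

/-! ### Leading exponents -/

section LeadingExp

variable {n : ℕ} (m : ArbMonomialOrder n)

theorem add_le_add {α β : Fin n →₀ ℕ} (h : m.le α β) (γ : Fin n →₀ ℕ) :
    m.le (α + γ) (β + γ) := by
  by_cases hαβ : α = β
  · rw [hαβ]; exact m.refl _
  · exact (m.add_lt_add α β γ ⟨h, hαβ⟩).1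

theorem exists_max (s : Finset (Fin n →₀ ℕ)) (hs : s.Nonempty) : ∃ a ∈ s, ∀ b ∈ s, m.le b a := by
  classical
  induction hs using Finset.Nonempty.cons_induction with
  | singleton a => exact ⟨a, by simp, by simpa using m.refl a⟩
  | cons a s _ _ ih =>
    obtain ⟨c, hc, hmax⟩ := ih
    rcases m.total a c with h | h
    · exact ⟨c, by simp [hc], by simpa [h] using hmax⟩
    · refine ⟨a, by simp, fun b hb => ?_⟩
      rcases Finset.mem_cons.1 hb with rfl | hb
      · exact m.refl _
      · exact m.trans _ _ _ (hmax b hb) h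

theorem exists_isLeadingExp {R : Type*} [CommRing R] {f : MvPolynomial (Fin n) R} (hf : f ≠ 0) :
    ∃ α, m.IsLeadingExp f α :=
  m.exists_max _ (support_nonempty.2 hf)

theorem IsLeadingExp.mul_monomial {R : Type*} [CommRing R] {m : ArbMonomialOrder n}
    {f : MvPolynomial (Fin n) R} {α : Fin n →₀ ℕ} (h : m.IsLeadingExp f α) (β : Fin n →₀ ℕ) :
    m.IsLeadingExp (f * monomial β 1) (α + β) := by
  refine ⟨?_, fun γ hγ => ?_⟩
  · rw [mem_support_iff, coeff_mul_monomial, mul_one]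
    exact mem_support_iff.1 h.1
  · rw [mem_support_iff, coeff_mul_monomial'] at hγ
    split_ifs at hγ with hle
    · rw [mul_one] at hγ
      rw [← tsub_add_cancel_of_le hle]
      exact m.add_le_add (h.2 _ (mem_support_iff.2 hγ)) β
    · exact absurd rfl hγ

/-- The exponents of the leading terms of the nonzero elements of a linear subspace. -/
def subspaceExps {K : Type*} [Field K] (W : Submodule K (MvPolynomial (Fin n) K)) :
    Set (Fin n →₀ ℕ) :=
  {α | ∃ f ∈ W, m.IsLeadingExp f α}

variable {K : Type*} [Field K] (W : Submodule K (MvPolynomial (Fin n) K))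

theorem linearIndependent_of_isLeadingExp {ι : Type*} {f : ι → MvPolynomial (Fin n) K}
    {e : ι → (Fin n →₀ ℕ)} (he : Function.Injective e) (h : ∀ i, m.IsLeadingExp (f i) (e i)) :
    LinearIndependent K f := by
  classical
  rw [linearIndependent_iff']
  intro s c hsum
  by_contra! hne
  have hT : ((s.filter fun i => c i ≠ 0).image e).Nonempty := by
    obtain ⟨i, hi, hci⟩ := hne
    exact ⟨e i, Finset.mem_image_of_mem _ (Finset.mem_filter.2 ⟨hi, hci⟩)⟩
  obtain ⟨a, ha, hmax⟩ := m.exists_max _ hT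
  obtain ⟨i, hi, rfl⟩ := Finset.mem_image.1 ha
  obtain ⟨his, hci⟩ := Finset.mem_filter.1 hi
  have hcoeff := congrArg (coeff (e i)) hsum
  rw [coeff_sum, coeff_zero, Finset.sum_eq_single_of_mem i his, coeff_smul, smul_eq_mul] at hcoeff
  · exact mul_ne_zero hci (mem_support_iff.1 (h i).1) hcoeff
  · intro j hj hji
    rw [coeff_smul, smul_eq_mul]
    by_contra hnz
    have hcj : c j ≠ 0 := left_ne_zero_of_mul hnz
    refine hji (he (m.antisymm _ _
      (hmax _ (Finset.mem_image_of_mem _ (Finset.mem_filter.2 ⟨hj, hcj⟩))) ?_))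
    exact (h j).2 _ (mem_support_iff.2 (right_ne_zero_of_mul hnz))

theorem exists_linearIndependent_subspaceExps :
    ∃ f : m.subspaceExps W → W, LinearIndependent K f := by
  choose f hf hlead using fun α : m.subspaceExps W => α.2
  have hli := m.linearIndependent_of_isLeadingExp Subtype.val_injective hlead
  exact ⟨fun α => ⟨f α, hf α⟩, LinearIndependent.of_comp W.subtype hli⟩

theorem finite_subspaceExps [FiniteDimensional K W] : (m.subspaceExps W).Finite := by
  obtain ⟨f, hf⟩ := m.exists_linearIndependent_subspaceExps W
  have := hf.finite
  exact Set.toFinite _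

/-- Elements with distinct leading exponents are linearly independent, and an element of the
subspace is determined by its coefficients at the leading exponents of the subspace; hence there
are as many leading exponents as dimensions. -/
theorem ncard_subspaceExps [FiniteDimensional K W] :
    (m.subspaceExps W).ncard = Module.finrank K W := by
  have hfin := m.finite_subspaceExps W
  have := hfin.fintype
  rw [← Nat.card_coe_set_eq, Nat.card_eq_fintype_card]
  apply le_antisymm
  · obtain ⟨f, hf⟩ := m.exists_linearIndependent_subspaceExps W
    exact hf.fintype_card_le_finrank
  · let ψ : W →ₗ[K] (m.subspaceExps W → K) :=
      (LinearMap.pi fun α => lcoeff K (α : Fin n →₀ ℕ)) ∘ₗ W.subtype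
    have hψ : Function.Injective ψ := by
      rw [← LinearMap.ker_eq_bot, LinearMap.ker_eq_bot']
      intro w hw
      by_contra hne
      obtain ⟨α, hα⟩ := m.exists_isLeadingExp fun h => hne (Subtype.ext h)
      exact mem_support_iff.1 hα.1 (congrFun hw ⟨α, w, w.2, hα⟩)
    simpa using LinearMap.finrank_le_finrank_of_injective hψ

end LeadingExp

/-! ### Truncations of the ideal by degree -/

section Truncation

variable {n : ℕ} (m : ArbMonomialOrder n) {R : Type*} [CommRing R]

/-- The multiples `x^β f` of elements `f ∈ S` by monomials with `|β| + deg f ≤ D`. -/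
def boundedMultiples (S : Set (MvPolynomial (Fin n) R)) (D : ℕ) : Set (MvPolynomial (Fin n) R) :=
  {p | ∃ f ∈ S, ∃ β : Fin n →₀ ℕ, β.degree + f.totalDegree ≤ D ∧ p = f * monomial β 1}

variable {S : Set (MvPolynomial (Fin n) R)}

theorem finite_boundedMultiples (hS : S.Finite) (D : ℕ) : (boundedMultiples S D).Finite := by
  refine (hS.image2 (fun f β => f * monomial β 1)
    (Finsupp.finite_of_degree_le (σ := Fin n) D)).subset ?_
  rintro _ ⟨f, hf, β, hβ, rfl⟩
  exact ⟨f, hf, β, (Nat.le_add_right _ _).trans hβ, rfl⟩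

theorem boundedMultiples_subset_span (D : ℕ) :
    boundedMultiples S D ⊆ (Ideal.span S : Set (MvPolynomial (Fin n) R)) := by
  rintro _ ⟨f, hf, β, -, rfl⟩
  exact Ideal.mul_mem_right _ _ (Ideal.subset_span hf)

theorem degree_le_of_mem_boundedMultiples {D : ℕ} {p : MvPolynomial (Fin n) R}
    (hp : p ∈ boundedMultiples S D) {α : Fin n →₀ ℕ} (hα : α ∈ p.support) : α.degree ≤ D := by
  obtain ⟨f, hf, β, hβ, rfl⟩ := hp
  rw [mem_support_iff, coeff_mul_monomial'] at hα
  split_ifs at hα with hle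
  · rw [mul_one] at hα
    have h : (α - β).degree ≤ f.totalDegree := le_totalDegree (mem_support_iff.2 hα)
    have h' : (α - β).degree + β.degree = α.degree := by
      rw [← map_add, tsub_add_cancel_of_le hle]
    omega
  · exact absurd rfl hα

variable {K : Type*} [Field K] (σ : R →+* K)

/-- The specialization at `σ` of the part of the ideal `(S)` that is generated in degrees at most
`D`. The degree bound refers to the elements of `S` before specialization. For `S = {f₁, …, f_s}`
this is, up to dehomogenization, the degree `D` part of the ideal generated by the specialized
homogenizations of the `fᵢ`. -/
noncomputable def truncation (S : Set (MvPolynomial (Fin n) R)) (D : ℕ) :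
    Submodule K (MvPolynomial (Fin n) K) :=
  Submodule.span K (map σ '' boundedMultiples S D)

theorem finiteDimensional_truncation (hS : S.Finite) (D : ℕ) :
    FiniteDimensional K (truncation σ S D) :=
  FiniteDimensional.span_of_finite K ((finite_boundedMultiples hS D).image _)

theorem map_mem_truncation {D : ℕ} {F : MvPolynomial (Fin n) R}
    (hF : F ∈ Submodule.span R (boundedMultiples S D)) : map σ F ∈ truncation σ S D := by
  induction hF using Submodule.span_induction with
  | mem x hx => exact Submodule.subset_span ⟨x, hx, rfl⟩
  | zero => rw [map_zero]; exact zero_mem _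
  | add x y _ _ hx hy => rw [map_add]; exact add_mem hx hy
  | smul c x _ hx =>
    rw [smul_eq_C_mul, map_mul, map_C, ← smul_eq_C_mul]
    exact Submodule.smul_mem _ _ hx

theorem truncation_mono {D D' : ℕ} (h : D ≤ D') : truncation σ S D ≤ truncation σ S D' := by
  refine Submodule.span_mono (Set.image_mono ?_)
  rintro _ ⟨f, hf, β, hβ, rfl⟩
  exact ⟨f, hf, β, hβ.trans h, rfl⟩

theorem mul_monomial_mem_truncation {D : ℕ} {f : MvPolynomial (Fin n) K}
    (hf : f ∈ truncation σ S D) (β : Fin n →₀ ℕ) :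
    f * monomial β 1 ∈ truncation σ S (D + β.degree) := by
  induction hf using Submodule.span_induction with
  | mem x hx =>
    obtain ⟨_, ⟨f, hf, γ, hγ, rfl⟩, rfl⟩ := hx
    refine Submodule.subset_span ⟨f * monomial (γ + β) 1, ⟨f, hf, γ + β, ?_, rfl⟩, ?_⟩
    · rw [map_add]; omega
    · simp only [map_mul, map_monomial, map_one]
      rw [mul_assoc, monomial_mul, one_mul]
  | zero => rw [zero_mul]; exact zero_mem _
  | add x y _ _ hx hy => rw [add_mul]; exact add_mem hx hy
  | smul c x _ hx => rw [smul_mul_assoc]; exact Submodule.smul_mem _ _ hx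

theorem degree_le_of_mem_truncation {D : ℕ} {f : MvPolynomial (Fin n) K}
    (hf : f ∈ truncation σ S D) {α : Fin n →₀ ℕ} (hα : α ∈ f.support) : α.degree ≤ D := by
  by_contra hlt
  refine mem_support_iff.1 hα ?_
  clear hα
  induction hf using Submodule.span_induction with
  | mem x hx =>
    obtain ⟨p, hp, rfl⟩ := hx
    by_contra hne
    exact hlt (degree_le_of_mem_boundedMultiples hp
      (support_map_subset _ _ (mem_support_iff.2 hne)))
  | zero => exact coeff_zero _
  | add x y _ _ hx hy => rw [coeff_add, hx, hy, add_zero]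
  | smul c x _ hx => rw [coeff_smul, hx, smul_zero]

theorem mem_map_span_iff_exists_truncation {f : MvPolynomial (Fin n) K} :
    f ∈ (Ideal.span S).map (map σ) ↔ ∃ D, f ∈ truncation σ S D := by
  constructor
  · intro hf
    rw [Ideal.map_span] at hf
    induction hf using Submodule.span_induction with
    | mem x hx =>
      obtain ⟨g, hg, rfl⟩ := hx
      exact ⟨g.totalDegree, Submodule.subset_span ⟨g, ⟨g, hg, 0, by simp, by simp⟩, rfl⟩⟩
    | zero => exact ⟨0, zero_mem _⟩
    | add x y _ _ hx hy =>
      obtain ⟨D, hx⟩ := hx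
      obtain ⟨E, hy⟩ := hy
      exact ⟨max D E, add_mem (truncation_mono σ (le_max_left _ _) hx)
        (truncation_mono σ (le_max_right _ _) hy)⟩
    | smul a x _ hx =>
      obtain ⟨D, hx⟩ := hx
      induction a using MvPolynomial.induction_on' with
      | monomial β c =>
        refine ⟨D + β.degree, ?_⟩
        have : monomial β c • x = c • (x * monomial β 1) := by
          rw [smul_eq_mul, mul_comm, ← mul_smul_comm, smul_monomial, smul_eq_mul, mul_one]
        rw [this]
        exact Submodule.smul_mem _ _ (mul_monomial_mem_truncation σ hx β)
      | add p q hp hq =>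
        obtain ⟨D, hp⟩ := hp
        obtain ⟨E, hq⟩ := hq
        rw [add_smul]
        exact ⟨max D E, add_mem (truncation_mono σ (le_max_left _ _) hp)
          (truncation_mono σ (le_max_right _ _) hq)⟩
  · rintro ⟨D, hf⟩
    have hle : truncation σ S D ≤
        ((Ideal.span S).map (map σ)).restrictScalars K := by
      refine Submodule.span_le.2 ?_
      rintro _ ⟨p, hp, rfl⟩
      exact Ideal.mem_map_of_mem _ (boundedMultiples_subset_span D hp)
    exact hle hf

/-- The leading exponents of all truncations of the specialized ideal, recorded in one upper set:
`(k, α)` belongs to it when `α` is a leading exponent in degree bound `k + |α|`. The number `k`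
plays the role of the exponent of a homogenizing variable. -/
noncomputable def specializedExps (S : Set (MvPolynomial (Fin n) R)) :
    UpperSet (ℕ × (Fin n →₀ ℕ)) where
  carrier := {x | x.2 ∈ m.subspaceExps (truncation σ S (x.1 + x.2.degree))}
  upper' := by
    rintro ⟨k, α⟩ ⟨l, β⟩ ⟨hkl, hαβ⟩ ⟨f, hf, hlead⟩
    obtain ⟨γ, rfl⟩ := exists_add_of_le hαβ
    refine ⟨f * monomial γ 1, ?_, hlead.mul_monomial γ⟩
    refine truncation_mono σ ?_ (mul_monomial_mem_truncation σ hf γ)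
    simp only [map_add] at hkl ⊢
    omega

theorem mem_specializedExps {x : ℕ × (Fin n →₀ ℕ)} :
    x ∈ m.specializedExps σ S ↔ x.2 ∈ m.subspaceExps (truncation σ S (x.1 + x.2.degree)) :=
  Iff.rfl

theorem mem_subspaceExps_truncation_iff {D : ℕ} {α : Fin n →₀ ℕ} :
    α ∈ m.subspaceExps (truncation σ S D) ↔
      α.degree ≤ D ∧ (D - α.degree, α) ∈ m.specializedExps σ S := by
  rw [mem_specializedExps]
  constructor
  · intro h
    have hle : α.degree ≤ D := by
      obtain ⟨f, hf, hlead⟩ := h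
      exact degree_le_of_mem_truncation σ hf hlead.1
    exact ⟨hle, by rwa [Nat.sub_add_cancel hle]⟩
  · rintro ⟨hle, h⟩
    rwa [Nat.sub_add_cancel hle] at h

theorem mem_leadingExps_map_span_iff {α : Fin n →₀ ℕ} :
    α ∈ m.leadingExps ((Ideal.span S).map (map σ)) ↔
      ∃ k, (k, α) ∈ m.specializedExps σ S := by
  constructor
  · rintro ⟨f, hf, hlead⟩
    obtain ⟨D, hD⟩ := (mem_map_span_iff_exists_truncation σ).1 hf
    exact ⟨_, ((m.mem_subspaceExps_truncation_iff σ).1 ⟨f, hD, hlead⟩).2⟩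
  · rintro ⟨k, f, hf, hlead⟩
    exact ⟨f, (mem_map_span_iff_exists_truncation σ).2 ⟨_, hf⟩, hlead⟩

/-- If `ker τ ⊆ ker σ`, the specialization at `σ` has in each degree at most as many leading
exponents as the one at `τ`; so it cannot contain all leading exponents of the latter without
being equal to it. -/
theorem specializedExps_eq_of_subset {L : Type*} [Field L] (τ : R →+* L) (hS : S.Finite)
    (hker : RingHom.ker τ ≤ RingHom.ker σ)
    (hsub : ∀ x ∈ m.specializedExps τ S, x ∈ m.specializedExps σ S) :
    m.specializedExps σ S = m.specializedExps τ S := by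
  refine SetLike.ext fun x => ⟨fun hx => ?_, hsub x⟩
  set D := x.1 + x.2.degree with hD
  have := finiteDimensional_truncation σ hS D
  have := finiteDimensional_truncation τ hS D
  have heq : m.subspaceExps (truncation τ S D) = m.subspaceExps (truncation σ S D) := by
    refine Set.eq_of_subset_of_ncard_le (fun α hα => ?_) ?_ (m.finite_subspaceExps _)
    · rw [mem_subspaceExps_truncation_iff] at hα ⊢
      exact ⟨hα.1, hsub _ hα.2⟩
    · rw [ncard_subspaceExps, ncard_subspaceExps]
      exact finrank_span_map_image_le σ τ hker (finite_boundedMultiples hS D)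
  rw [mem_specializedExps, ← hD] at hx ⊢
  rwa [heq]

end Truncation

/-! ### Generic standard bases -/

section Generic

variable {n : ℕ} (m : ArbMonomialOrder n) {R : Type*} [CommRing R]
  {S : Set (MvPolynomial (Fin n) R)} {Q p : Ideal R}

theorem isLeadingExp_map_of_mem_radical {K : Type*} [Field K] {σ : R →+* K}
    {F : MvPolynomial (Fin n) R} {α : Fin n →₀ ℕ} (hσQ : ∀ q ∈ Q, σ q = 0)
    (hσ : σ (coeff α F) ≠ 0) (hF : ∀ β, ¬ m.le β α → coeff β F ∈ Q.radical) :
    m.IsLeadingExp (map σ F) α := by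
  refine ⟨by rwa [mem_support_iff, coeff_map], fun β hβ => ?_⟩
  rw [mem_support_iff, coeff_map] at hβ
  by_contra hle
  obtain ⟨k, hk⟩ := hF β hle
  exact hβ (eq_zero_of_pow_eq_zero (by rw [← map_pow]; exact hσQ _ hk))

/-- A leading exponent of the specialization at a minimal prime `p` over `Q` is realized by one
polynomial near `p` in `V(Q)`: the coefficients above the leading one lie in `p`, hence are carried
into the radical of `Q` by a factor outside `p`. -/
theorem exists_lift_isLeadingExp [p.IsPrime] (hp : p ∈ Q.minimalPrimes)
    {x : ℕ × (Fin n →₀ ℕ)} (hx : x ∈ m.specializedExps (algebraMap R p.ResidueField) S) :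
    ∃ F ∈ Submodule.span R (boundedMultiples S (x.1 + x.2.degree)),
      coeff x.2 F ∉ p ∧ ∀ β, ¬ m.le β x.2 → coeff β F ∈ Q.radical := by
  classical
  obtain ⟨f, hf, hlead⟩ := hx
  obtain ⟨s, hs, F, hF, hFf⟩ := exists_lift_mem_span p _ hf
  have hs0 : algebraMap R p.ResidueField s ≠ 0 := fun h =>
    hs (Ideal.algebraMap_residueField_eq_zero.1 h)
  have hcoeff : ∀ β, algebraMap R p.ResidueField (coeff β F) =
      algebraMap R p.ResidueField s * coeff β f := fun β => by
    rw [← coeff_map, hFf, coeff_smul, smul_eq_mul]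
  have hmem : ∀ a ∈ (F.support.filter fun β => ¬ m.le β x.2).image fun β => coeff β F, a ∈ p := by
    intro a ha
    obtain ⟨β, hβ, rfl⟩ := Finset.mem_image.1 ha
    have hβf : coeff β f = 0 := by
      by_contra h
      exact (Finset.mem_filter.1 hβ).2 (hlead.2 β (mem_support_iff.2 h))
    rw [← Ideal.algebraMap_residueField_eq_zero, hcoeff, hβf, mul_zero]
  obtain ⟨t, ht, htmul⟩ := Ideal.exists_notMem_forall_mul_mem_radical hp _ hmem
  have hc : coeff x.2 F ∉ p := fun h => by
    rw [← Ideal.algebraMap_residueField_eq_zero, hcoeff] at h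
    exact mul_ne_zero hs0 (mem_support_iff.1 hlead.1) h
  refine ⟨t • F, Submodule.smul_mem _ _ hF, ?_, fun β hle => ?_⟩
  · rw [coeff_smul, smul_eq_mul]
    exact p.primeCompl.mul_mem ht hc
  · rw [coeff_smul, smul_eq_mul]
    by_cases h : coeff β F = 0
    · rw [h, mul_zero]; exact zero_mem _
    · exact htmul _ (Finset.mem_image_of_mem _
        (Finset.mem_filter.2 ⟨mem_support_iff.2 h, hle⟩))

theorem mem_specializedExps_of_lift {K : Type*} [Field K] (σ : R →+* K)
    {U : UpperSet (ℕ × (Fin n →₀ ℕ))} {T : Finset (ℕ × (Fin n →₀ ℕ))}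
    {F : ℕ × (Fin n →₀ ℕ) → MvPolynomial (Fin n) R} (hT : ∀ x ∈ U, ∃ y ∈ T, y ≤ x)
    (hF : ∀ x ∈ T, F x ∈ Submodule.span R (boundedMultiples S (x.1 + x.2.degree)))
    (hlead : ∀ x ∈ T, m.IsLeadingExp (map σ (F x)) x.2) :
    ∀ x ∈ U, x ∈ m.specializedExps σ S := by
  intro x hx
  obtain ⟨y, hy, hyx⟩ := hT x hx
  exact (m.specializedExps σ S).upper hyx ⟨_, map_mem_truncation σ (hF y hy), hlead y hy⟩

/-- The leading exponents are constant on a nonempty open subset of `V(Q)`. The element `h` avoids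
even the radical of `Q`, so that `σ(Q) = 0` and `σ(h) ≠ 0` for some specialization. -/
theorem exists_generic_standardBasis (hS : S.Finite) (hQ : Q ≠ ⊤) :
    ∃ (G : Set (MvPolynomial (Fin n) R)) (h : R),
      G.Finite ∧ G ⊆ (Ideal.span S : Set (MvPolynomial (Fin n) R)) ∧ h ∉ Q.radical ∧
      (∀ (K : Type v) [Field K] (σ : R →+* K), (∀ q ∈ Q, σ q = 0) → σ h ≠ 0 →
        m.IsStandardBasis (map σ '' G) ((Ideal.span S).map (map σ))) ∧
      (∀ g ∈ G, ∃ α : Fin n →₀ ℕ,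
        ∀ (K : Type v) [Field K] (σ : R →+* K), (∀ q ∈ Q, σ q = 0) → σ h ≠ 0 →
          m.IsLeadingExp (map σ g) α) := by
  classical
  have hprime : ∀ p : Q.minimalPrimes, p.1.IsPrime := fun p => p.2.1.1
  have := Ideal.nonempty_minimalPrimes hQ
  -- A minimal prime whose upper set of leading exponents is maximal for inclusion: `V(Q)` may have
  -- infinitely many components, and a neighbourhood of a generic point may meet many of them.
  let E : Q.minimalPrimes → UpperSet (ℕ × (Fin n →₀ ℕ)) := fun p =>
    m.specializedExps (algebraMap R p.1.ResidueField) S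
  have hwf := UpperSet.wellFoundedLT_of_wellQuasiOrderedLE (α := ℕ × (Fin n →₀ ℕ))
  obtain ⟨_, ⟨p, rfl⟩, hmax⟩ := hwf.wf.has_min (Set.range E) (Set.range_nonempty E)
  have hp := hprime p
  obtain ⟨T, hTE, hT⟩ := (E p).exists_finset_generators
  choose! F hFspan hFp hFrad using fun x (hx : x ∈ T) =>
    m.exists_lift_isLeadingExp p.2 (hTE x hx)
  let h : R := ∏ x ∈ T, coeff x.2 (F x)
  have hhp : h ∉ p.1 := fun hh => by
    obtain ⟨x, hx, hxp⟩ := hp.prod_mem_iff.1 hh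
    exact hFp x hx hxp
  have hdvd : ∀ x ∈ T, coeff x.2 (F x) ∣ h := fun x hx => Finset.dvd_prod_of_mem _ hx
  have hlead : ∀ x ∈ T, ∀ (K : Type v) [Field K] (σ : R →+* K), (∀ q ∈ Q, σ q = 0) →
      σ h ≠ 0 → m.IsLeadingExp (map σ (F x)) x.2 := fun x hx K _ σ hσQ hσh =>
    m.isLeadingExp_map_of_mem_radical hσQ (ne_zero_of_dvd_ne_zero hσh (map_dvd σ (hdvd x hx)))
      (hFrad x hx)
  have hconst : ∀ (K : Type v) [Field K] (σ : R →+* K), (∀ q ∈ Q, σ q = 0) → σ h ≠ 0 →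
      m.specializedExps σ S = E p := by
    intro K _ σ hσQ hσh
    -- Compare `σ` with the generic point `p'` of a component of `V(Q)` through `ker σ`.
    have hker : (RingHom.ker σ).IsPrime := RingHom.ker_isPrime σ
    obtain ⟨p', hp', hle⟩ := Ideal.exists_minimalPrimes_le (I := Q) (J := RingHom.ker σ) hσQ
    have hp'' : p'.IsPrime := hp'.1.1
    have hτ : E ⟨p', hp'⟩ = E p := by
      have hsub : E ⟨p', hp'⟩ ≤ E p := by
        refine m.mem_specializedExps_of_lift _ hT hFspan fun x hx => ?_
        refine m.isLeadingExp_map_of_mem_radical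
          (fun q hq => Ideal.algebraMap_residueField_eq_zero.2 (hp'.1.2 hq)) ?_ (hFrad x hx)
        refine ne_zero_of_dvd_ne_zero (fun h0 => ?_) (map_dvd _ (hdvd x hx))
        exact hσh (hle (Ideal.algebraMap_residueField_eq_zero.1 h0))
      exact hsub.eq_of_not_lt (hmax _ ⟨_, rfl⟩)
    rw [← hτ]
    refine m.specializedExps_eq_of_subset σ _ hS
      ((Ideal.ker_algebraMap_residueField p').trans_le hle) ?_
    change ∀ x ∈ E ⟨p', hp'⟩, _
    rw [hτ]
    exact m.mem_specializedExps_of_lift σ hT hFspan fun x hx => hlead x hx K σ hσQ hσh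
  refine ⟨F '' T, h, T.finite_toSet.image F, ?_, fun hh => hhp (hp.radical_le_iff.2 p.2.1.2 hh),
    ?_, ?_⟩
  · rintro _ ⟨x, hx, rfl⟩
    have hle : Submodule.span R (boundedMultiples S (x.1 + x.2.degree)) ≤
        (Ideal.span S).restrictScalars R :=
      Submodule.span_le.2 (boundedMultiples_subset_span _)
    exact hle (hFspan x hx)
  · intro K _ σ hσQ hσh
    have hexps := hconst K σ hσQ hσh
    refine ⟨(T.finite_toSet.image F).image _, ?_, ?_, ?_⟩
    · rintro _ ⟨_, ⟨x, hx, rfl⟩, rfl⟩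
      exact (mem_map_span_iff_exists_truncation σ).2 ⟨_, map_mem_truncation σ (hFspan x hx)⟩
    · rintro _ ⟨_, ⟨x, hx, rfl⟩, rfl⟩ h0
      have h1 := (hlead x hx K σ hσQ hσh).1
      rw [h0] at h1
      simp at h1
    · ext α
      rw [mem_leadingExps_map_span_iff, hexps]
      simp only [Set.mem_iUnion, Set.mem_ofPred_eq, exists_prop]
      constructor
      · rintro ⟨k, hk⟩
        obtain ⟨x, hx, hxk⟩ := hT _ hk
        obtain ⟨δ, hδ⟩ := exists_add_of_le hxk.2
        exact ⟨_, ⟨_, ⟨x, hx, rfl⟩, rfl⟩, x.2, δ, hlead x hx K σ hσQ hσh, hδ⟩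
      · rintro ⟨_, ⟨_, ⟨x, hx, rfl⟩, rfl⟩, ε, δ, hε, rfl⟩
        have hεx := hlead x hx K σ hσQ hσh
        obtain rfl : ε = x.2 := m.antisymm _ _ (hεx.2 _ hε.1) (hε.2 _ hεx.1)
        have hle : x ≤ (x.1, x.2 + δ) := ⟨le_rfl, le_self_add⟩
        exact ⟨x.1, (E p).upper hle (hTE x hx)⟩
  · rintro _ ⟨x, hx, rfl⟩
    exact ⟨x.2, hlead x hx⟩

end Generic

end ArbMonomialOrder

theorem mainTheorem1 {C : Type u} [CommRing C] [IsDomain C] {n : ℕ}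
    (m : ArbMonomialOrder n)
    (J : Ideal (MvPolynomial (Fin n) C)) (Q : Ideal C) (hJ : J.FG) (hQ : Q.FG)
    (hJQ : ¬ J ≤ Q.map (MvPolynomial.C : C →+* MvPolynomial (Fin n) C)) :
    ∃ (G : Set (MvPolynomial (Fin n) C)) (r : ℕ) (h : Fin r → C),
      G.Finite ∧ G ⊆ (J : Set (MvPolynomial (Fin n) C)) ∧ (∀ i, h i ∉ Q) ∧
      (∀ (K : Type v) [Field K] (σ : C →+* K), (∀ q ∈ Q, σ q = 0) → σ (∏ i, h i) ≠ 0 →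
        m.IsStandardBasis (MvPolynomial.map σ '' G) (J.map (MvPolynomial.map σ))) ∧
      (∀ g ∈ G, ∃ α : Fin n →₀ ℕ,
        ∀ (K : Type v) [Field K] (σ : C →+* K), (∀ q ∈ Q, σ q = 0) → σ (∏ i, h i) ≠ 0 →
          m.IsLeadingExp (MvPolynomial.map σ g) α) := by
  obtain ⟨S, rfl⟩ := hJ
  have hQtop : Q ≠ ⊤ := by
    rintro rfl
    exact hJQ (by rw [Ideal.map_top]; exact le_top)
  obtain ⟨G, h, hfin, hsub, hh, hbasis, hexp⟩ :=
    m.exists_generic_standardBasis S.finite_toSet hQtop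
  refine ⟨G, 1, fun _ => h, hfin, hsub, fun _ hQh => hh (Ideal.le_radical hQh), ?_, ?_⟩
  · intro K _ σ hσQ hσh
    exact hbasis K σ hσQ (by simpa using hσh)
  · intro g hg
    obtain ⟨α, hα⟩ := hexp g hg
    exact ⟨α, fun K _ σ hσQ hσh => hα K σ hσQ (by simpa using hσh)⟩
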